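/- A $k$-uniform hypergraph $H=(V,E)$ consists of a finite vertex set $V$ and a set $E$ of $k$-element subsets of $V$. A (linear) embedding of $H$ into $\mathbb{R}^D$ is a map $\varphi:V\to\mathbb{R}^D$ such that $\dim\operatorname{aff}\varphi(e)=k-1$ for all $e\in E$, and $\operatorname{conv}\varphi(e_1\cap e_2)=\operatorname{conv}\varphi(e_1)\cap\operatorname{conv}\varphi(e_2)$ for all $e_1,e_2\in E$; $H$ is $D$-embeddable if such a map exists. A weak $c$-coloring of $H$ is a map $\kappa:V\to\{1,\dots,c\}$ with $|\kappa(e)|>1$ for all $e\in E$, and the weak chromatic number $\chi^{\mathsf w}(H)$ is the least $c\in\mathbb{N}$ for which a weak $c$-coloring exists. Let $$\chi^{\mathsf w}_{D,k}(n)=\max\{\chi^{\mathsf w}(H): H \text{ a } D\text{-embeddable } k\text{-uniform hypergraph with } |V(H)|=n\}.$$ **Theorem.** Let $d\ge 3$. Then, as $n\to\infty$, $$\chi^{\mathsf w}_{2d-3,\,d}(n)=\Omega\!\left(\frac{\log n}{\log\log n}\right),$$ that is, there are a constant $c_d>0$ and an $n_0$ (both possibly depending on $d$) such that $\chi^{\mathsf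 w}_{2d-3,d}(n)\ge c_d\,\frac{\log n}{\log\log n}$ for all $n\ge n_0$. -/

import Mathlib

namespace Hypergraph

/-- `H` is a (finite) `k`-uniform hypergraph: its vertex set is finite and each of its edges
is a `k`-element set of vertices. -/
def IsFiniteUniform {α : Type*} (H : Hypergraph α) (k : ℕ) : Prop :=
  H.vertexSet.Finite ∧ ∀ e ∈ H.edgeSet, e.ncard = k

/-- `κ`, restricted to the vertex set, is a weak `c`-coloring of `H`: it takes values in
`{1, …, c}` on the vertices, and no edge is monochromatic (every edge receives more than one
color). -/
def IsWeakColoring {α : Type*} (H : Hypergraph α) (c : ℕ) (κ : α → ℕ) : Prop :=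
  (∀ v ∈ H.vertexSet, κ v ∈ Set.Icc 1 c) ∧ ∀ e ∈ H.edgeSet, 1 < (κ '' e).ncard

/-- The weak chromatic number: the least `c` such that `H` has a weak `c`-coloring. -/
noncomputable def weakChromaticNumber {α : Type*} (H : Hypergraph α) : ℕ :=
  sInf {c : ℕ | ∃ κ : α → ℕ, H.IsWeakColoring c κ}

/-- `φ`, restricted to the vertex set, is a linear embedding of the `k`-uniform hypergraph `H`
into `ℝ^d`: the affine hull of the image of each edge has dimension `k - 1`, and the convex
hulls of the images of two edges meet exactly in the convex hull of the image of their
common vertices. -/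
def IsLinearEmbedding {α : Type*} (H : Hypergraph α) (k d : ℕ) (φ : α → (Fin d → ℝ)) : Prop :=
  (∀ e ∈ H.edgeSet, Module.finrank ℝ (affineSpan ℝ (φ '' e)).direction = k - 1) ∧
  ∀ e₁ ∈ H.edgeSet, ∀ e₂ ∈ H.edgeSet,
    convexHull ℝ (φ '' (e₁ ∩ e₂)) = convexHull ℝ (φ '' e₁) ∩ convexHull ℝ (φ '' e₂)

/-- `H` is a `d`-embeddable `k`-uniform hypergraph. -/
def IsEmbeddableUniform {α : Type*} (H : Hypergraph α) (d k : ℕ) : Prop :=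
  H.IsFiniteUniform k ∧ ∃ φ : α → (Fin d → ℝ), H.IsLinearEmbedding k d φ

/-- The weak chromatic numbers of the `d`-embeddable `k`-uniform hypergraphs on `n` vertices. -/
def weakChromaticNumbers (d k n : ℕ) : Set ℕ :=
  {c : ℕ | ∃ (α : Type) (H : Hypergraph α),
    H.IsEmbeddableUniform d k ∧ H.vertexSet.ncard = n ∧ H.weakChromaticNumber = c}

/-- The maximum weak chromatic number of a `d`-embeddable `k`-uniform hypergraph on `n`
vertices. For `k ≥ 2` it is a true maximum, see `isGreatest_maxWeakChromaticNumber`. -/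
noncomputable def maxWeakChromaticNumber (d k n : ℕ) : ℕ :=
  sSup (weakChromaticNumbers d k n)

/-- A finite `k`-uniform hypergraph with `k ≥ 2` has a weak coloring with as many colors as
it has vertices. -/
theorem IsFiniteUniform.exists_isWeakColoring {α : Type*} {H : Hypergraph α} {k : ℕ}
    (hH : H.IsFiniteUniform k) (hk : 2 ≤ k) :
    ∃ κ : α → ℕ, H.IsWeakColoring H.vertexSet.ncard κ := by
  classical
  obtain ⟨hfin, hcard⟩ := hH
  have : Finite H.vertexSet := hfin
  let f : H.vertexSet ≃ Fin H.vertexSet.ncard := Finite.equivFin H.vertexSet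
  refine ⟨fun v => if h : v ∈ H.vertexSet then (f ⟨v, h⟩ : ℕ) + 1 else 0, ?_, ?_⟩
  · intro v hv
    have := (f ⟨v, hv⟩).2
    simp only [hv, dif_pos, Set.mem_Icc]
    omega
  · intro e he
    rw [Set.InjOn.ncard_image, hcard e he]
    · omega
    · intro v hv w hw hvw
      have hv' := H.mem_vertexSet_of_mem_edgeSet he hv
      have hw' := H.mem_vertexSet_of_mem_edgeSet he hw
      simp only [hv', hw', dif_pos, Nat.add_right_cancel_iff] at hvw
      simpa using f.injective (Fin.ext hvw)

/-- For `k ≥ 2` the supremum in `maxWeakChromaticNumber` is attained. -/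
theorem isGreatest_maxWeakChromaticNumber {d k n : ℕ} (hk : 2 ≤ k) :
    IsGreatest (weakChromaticNumbers d k n) (maxWeakChromaticNumber d k n) := by
  have hb : BddAbove (weakChromaticNumbers d k n) := by
    refine ⟨n, ?_⟩
    rintro _ ⟨α, H, hH, rfl, rfl⟩
    exact Nat.sInf_le (hH.1.exists_isWeakColoring hk)
  have hne : (weakChromaticNumbers d k n).Nonempty := by
    refine ⟨_, Fin n, trivialOn Set.univ, ⟨⟨Set.toFinite _, by simp⟩, 0, by simp, by simp⟩,
      by simp [Set.ncard_univ], rfl⟩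
  exact ⟨Nat.sSup_mem hne hb, fun c hc => le_csSup hb hc⟩

end Hypergraph

/-! Put all vertices on the moment curve in `ℝ^D`. Affine functions on `ℝ^D` restrict to polynomials
of degree at most `D` on the curve, so two edges meet properly as soon as such a polynomial
separates them in the sense of `SeparatedBy`. Only the order of the vertices and the multiset of
roots matter, which makes the problem combinatorial.

Write `d = k + 3`, so `D = 2 * k + 3`. From a family not colorable with `c` colors, build one for `c
+ 1`: take `N > (c + 1) * (k + 1)` base points, attach a copy of the old family to every `(k +
2)`-set `S` of base points, and add as edges all cones `S ∪ {v}` with `v` in the copy of `S`. By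
pigeonhole some `S` is monochromatic. If its color recurs in its copy, a cone is monochromatic;
otherwise the copy uses only `c` colors and induction applies (`IsUncolorableFamily.stacked`).

Embeddability depends on the order: each copy comes after the greatest element of its `S`, and
copies there are sorted by least element. The critical case is two cones, `separatedBy_cone_cone`,
which uses the full budget of `2 * k + 3` roots. The number of vertices grows like `c ^ O(c)`, and
inverting this gives the bound. -/

/-! ### Separation by polynomials on the moment curve -/

/-- The moment curve in `ℝ^D`. -/
def momentCurve (D : ℕ) (t : ℝ) : Fin D → ℝ := fun i => t ^ ((i : ℕ) + 1)

open Polynomial in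
/-- The affine function on `ℝ^D` which restricts to `p` along the moment curve,
if `p` has degree at most `D`. -/
def momentFunctional (D : ℕ) (p : ℝ[X]) (y : Fin D → ℝ) : ℝ :=
  p.coeff 0 + ∑ i : Fin D, p.coeff ((i : ℕ) + 1) * y i

open Polynomial in
theorem momentFunctional_momentCurve {D : ℕ} {p : ℝ[X]} (hp : p.natDegree ≤ D) (t : ℝ) :
    momentFunctional D p (momentCurve D t) = p.eval t := by
  rw [Polynomial.eval_eq_sum_range' (Nat.lt_succ_of_le hp), Finset.sum_range_succ',
    ← Fin.sum_univ_eq_sum_range (fun i => p.coeff (i + 1) * t ^ (i + 1)) D]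
  simp [momentFunctional, momentCurve, add_comm]

-- The total weight is left arbitrary: weight 0 serves affine independence, weight 1 serves convex
-- combinations.
open Polynomial in
theorem momentFunctional_sum {D : ℕ} (p : ℝ[X]) {ι : Type*} (s : Finset ι) (w : ι → ℝ)
    (y : ι → Fin D → ℝ) :
    ∑ i ∈ s, w i * momentFunctional D p (y i) =
      p.coeff 0 * (∑ i ∈ s, w i) +
        ∑ j : Fin D, p.coeff ((j : ℕ) + 1) * (∑ i ∈ s, w i • y i) j := by
  simp only [momentFunctional, mul_add, Finset.sum_add_distrib, Finset.mul_sum,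
    Finset.sum_apply, Pi.smul_apply, smul_eq_mul]
  rw [Finset.sum_comm]
  congr 1
  · exact Finset.sum_congr rfl fun i _ => mul_comm _ _
  · exact Finset.sum_congr rfl fun j _ => Finset.sum_congr rfl fun i _ => by ring

theorem momentCurve_injective {D : ℕ} (hD : 0 < D) : Function.Injective (momentCurve D) := by
  intro a b h
  simpa [momentCurve] using congrFun h ⟨0, hD⟩

open Polynomial in
/-- At most `D + 1` distinct points of the moment curve are affinely independent. -/
theorem affineIndependent_momentCurve {D : ℕ} {ι : Type*} [Fintype ι] {t : ι → ℝ}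
    (ht : Function.Injective t) (hcard : Fintype.card ι ≤ D + 1) :
    AffineIndependent ℝ (fun i => momentCurve D (t i)) := by
  classical
  rw [affineIndependent_iff]
  intro s w hw hws i hi
  -- Vanishes at every parameter of `s` except `t i`, hence isolates the weight `w i`.
  let p : ℝ[X] := ∏ j ∈ s.erase i, (X - C (t j))
  have hp : p.natDegree ≤ D := by
    rw [natDegree_prod_of_monic _ _ fun j _ => monic_X_sub_C _]
    simp only [natDegree_X_sub_C, Finset.sum_const, smul_eq_mul, mul_one,
      Finset.card_erase_of_mem hi]
    have := s.card_le_univ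
    omega
  have h := momentFunctional_sum p s w fun j => momentCurve D (t j)
  rw [hws, hw] at h
  simp only [momentFunctional_momentCurve hp, mul_zero, Pi.zero_apply, Finset.sum_const_zero,
    add_zero] at h
  rw [Finset.sum_eq_single_of_mem i hi] at h
  · refine (mul_eq_zero.1 h).resolve_right ?_
    rw [eval_prod, ← ne_eq, Finset.prod_ne_zero_iff]
    intro j hj
    simp only [eval_sub, eval_X, eval_C, sub_ne_zero]
    exact fun hij => (Finset.ne_of_mem_erase hj) (ht hij.symm)
  · intro j hj hji
    rw [eval_prod, Finset.prod_eq_zero (Finset.mem_erase.2 ⟨hji, hj⟩) (by simp), mul_zero]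

open Polynomial in
/-- If a polynomial of degree at most `D` separates the parameters of two finite sets of points
on the moment curve, then their convex hulls intersect only in the hull of the common points. -/
theorem convexHull_inter_subset_of_polynomial {D : ℕ} (hD : 0 < D) {p : ℝ[X]}
    (hp : p.natDegree ≤ D) {s₁ s₂ : Finset ℝ} (h₁ : ∀ t ∈ s₁, t ∉ s₂ → 0 < p.eval t)
    (h₂ : ∀ t ∈ s₂, p.eval t ≤ 0) (h₁₂ : ∀ t ∈ s₁, t ∈ s₂ → p.eval t = 0) :
    convexHull ℝ (momentCurve D '' s₁) ∩ convexHull ℝ (momentCurve D '' s₂) ⊆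
      convexHull ℝ (momentCurve D '' (s₁ ∩ s₂ : Finset ℝ)) := by
  classical
  have hinj := momentCurve_injective hD
  have key : ∀ s : Finset ℝ, ∀ x, x ∈ convexHull ℝ (momentCurve D '' s) ↔
      ∃ w : ℝ → ℝ, (∀ t ∈ s, 0 ≤ w t) ∧ ∑ t ∈ s, w t = 1 ∧
        ∑ t ∈ s, w t • momentCurve D t = x := by
    intro s x
    rw [← Finset.coe_image, Finset.mem_convexHull']
    constructor
    · rintro ⟨w, h0, h1, h2⟩
      rw [Finset.sum_image hinj.injOn] at h1 h2
      exact ⟨fun t => w (momentCurve D t),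
        fun t ht => h0 _ (Finset.mem_image_of_mem _ ht), h1, h2⟩
    · rintro ⟨w, h0, h1, h2⟩
      refine ⟨fun y => w (Function.invFun (momentCurve D) y), ?_, ?_, ?_⟩
      · intro y hy
        obtain ⟨t, ht, rfl⟩ := Finset.mem_image.1 hy
        simpa [Function.leftInverse_invFun hinj t] using h0 t ht
      · rw [Finset.sum_image hinj.injOn, ← h1]
        exact Finset.sum_congr rfl fun t _ => by rw [Function.leftInverse_invFun hinj t]
      · rw [Finset.sum_image hinj.injOn, ← h2]
        exact Finset.sum_congr rfl fun t _ => by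
          dsimp only
          rw [Function.leftInverse_invFun hinj t]
  rintro x ⟨hx₁, hx₂⟩
  rw [key] at hx₁ hx₂ ⊢
  obtain ⟨w, hw0, hw1, hwx⟩ := hx₁
  obtain ⟨u, hu0, hu1, hux⟩ := hx₂
  -- Evaluate the functional at `x` through both convex combinations: one gives a value `≥ 0`, the
  -- other `≤ 0`. So every term over `s₁` vanishes, and the weights outside `s₂` are zero.
  have hw := momentFunctional_sum p s₁ w (momentCurve D)
  have hu := momentFunctional_sum p s₂ u (momentCurve D)
  rw [hwx, hw1] at hw
  rw [hux, hu1, ← hw] at hu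
  simp only [momentFunctional_momentCurve hp] at hu
  have hterm : ∀ t ∈ s₁, 0 ≤ w t * p.eval t := by
    intro t ht
    by_cases h : t ∈ s₂
    · simp [h₁₂ t ht h]
    · exact mul_nonneg (hw0 t ht) (h₁ t ht h).le
  have hle : ∑ t ∈ s₁, w t * p.eval t ≤ 0 := by
    rw [← hu]
    exact Finset.sum_nonpos fun t ht => mul_nonpos_of_nonneg_of_nonpos (hu0 t ht) (h₂ t ht)
  have hzero := (Finset.sum_eq_zero_iff_of_nonneg hterm).1
    (le_antisymm hle (Finset.sum_nonneg hterm))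
  have hw' : ∀ t ∈ s₁, t ∉ s₁ ∩ s₂ → w t = 0 := by
    intro t ht hts
    have h : t ∉ s₂ := fun h => hts (Finset.mem_inter.2 ⟨ht, h⟩)
    exact (mul_eq_zero.1 (hzero t ht)).resolve_right (h₁ t ht h).ne'
  refine ⟨w, fun t ht => hw0 t (Finset.mem_inter.1 ht).1, ?_, ?_⟩
  · rw [← hw1]
    exact Finset.sum_subset Finset.inter_subset_left hw'
  · rw [← hwx]
    exact Finset.sum_subset Finset.inter_subset_left fun t ht hts => by
      rw [hw' t ht hts, zero_smul]

/-! ### Sign patterns and separation in an abstract linear order -/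

/-- The sign of `a - b` in a linear order. -/
def ordSign {α : Type*} [LinearOrder α] (a b : α) : SignType :=
  if a < b then -1 else if a = b then 0 else 1

section ordSign

variable {α : Type*} [LinearOrder α] {a b : α}

theorem ordSign_of_lt (h : a < b) : ordSign a b = -1 := by simp [ordSign, h]

@[simp] theorem ordSign_self (a : α) : ordSign a a = 0 := by simp [ordSign]

theorem ordSign_of_gt (h : b < a) : ordSign a b = 1 := by simp [ordSign, h.not_gt, h.ne']

theorem ordSign_eq_zero_iff : ordSign a b = 0 ↔ a = b := by
  rcases lt_trichotomy a b with h | rfl | h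
  · simp [ordSign_of_lt h, h.ne]
  · simp
  · simp [ordSign_of_gt h, h.ne']

theorem StrictMono.ordSign_eq {β : Type*} [LinearOrder β] {f : α → β} (hf : StrictMono f) :
    ordSign (f a) (f b) = ordSign a b := by
  simp [ordSign, hf.lt_iff_lt, hf.injective.eq_iff]

theorem sign_sub_eq_ordSign (a b : ℝ) : SignType.sign (a - b) = ordSign a b := by
  rcases lt_trichotomy a b with h | rfl | h
  · rw [ordSign_of_lt h, sign_neg (sub_neg.2 h)]
  · simp
  · rw [ordSign_of_gt h, sign_pos (sub_pos.2 h)]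

end ordSign

/-- The sign at `t` of a monic polynomial with roots `R`. -/
def rootSign {α : Type*} [LinearOrder α] (R : Multiset α) (t : α) : SignType :=
  (R.map (ordSign t)).prod

section rootSign

variable {α : Type*} [LinearOrder α]

@[simp] theorem rootSign_zero (t : α) : rootSign 0 t = 1 := by simp [rootSign]

@[simp] theorem rootSign_cons (r : α) (R : Multiset α) (t : α) :
    rootSign (r ::ₘ R) t = ordSign t r * rootSign R t := by simp [rootSign]

@[simp] theorem rootSign_add (R Q : Multiset α) (t : α) :
    rootSign (R + Q) t = rootSign R t * rootSign Q t := by simp [rootSign]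

theorem rootSign_eq_zero_iff {R : Multiset α} {t : α} : rootSign R t = 0 ↔ t ∈ R := by
  simp [rootSign, Multiset.prod_eq_zero_iff, ordSign_eq_zero_iff]

theorem StrictMono.rootSign_map {β : Type*} [LinearOrder β] {f : α → β} (hf : StrictMono f)
    (R : Multiset α) (t : α) : rootSign (R.map f) (f t) = rootSign R t := by
  simp [rootSign, Multiset.map_map, hf.ordSign_eq]

open Polynomial in
theorem sign_eval_prod_X_sub_C (R : Multiset ℝ) (t : ℝ) :
    SignType.sign (((R.map fun r => X - C r).prod).eval t) = rootSign R t := by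
  induction R using Multiset.induction_on with
  | empty => simp
  | cons r R ih => simp [sign_mul, ih, sign_sub_eq_ordSign]

/-- The sign pattern of a monic polynomial of degree at most `D`, with roots in the given linear
order, separates `e₁` from `e₂`: it vanishes on the common points, is positive on the remaining
points of `e₁` and nowhere positive on `e₂`. -/
def SeparatedBy (D : ℕ) (e₁ e₂ : Finset α) : Prop :=
  ∃ R : Multiset α, R.card ≤ D ∧ (∀ t ∈ e₁, t ∉ e₂ → rootSign R t = 1) ∧
    (∀ t ∈ e₂, rootSign R t ≤ 0) ∧ ∀ t ∈ e₁, t ∈ e₂ → rootSign R t = 0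

theorem SeparatedBy.image {D : ℕ} {e₁ e₂ : Finset α} (h : SeparatedBy D e₁ e₂)
    {β : Type*} [LinearOrder β] {f : α → β} (hf : StrictMono f) :
    SeparatedBy D (e₁.image f) (e₂.image f) := by
  obtain ⟨R, hR, h1, h2, h3⟩ := h
  refine ⟨R.map f, by simpa using hR, ?_, ?_, ?_⟩ <;>
    simp only [Finset.forall_mem_image, hf.rootSign_map, hf.injective.mem_finset_image] <;>
    assumption

open Polynomial in
theorem SeparatedBy.convexHull_inter_subset {D : ℕ} (hD : 0 < D) {s₁ s₂ : Finset ℝ}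
    (h : SeparatedBy D s₁ s₂) :
    convexHull ℝ (momentCurve D '' s₁) ∩ convexHull ℝ (momentCurve D '' s₂) ⊆
      convexHull ℝ (momentCurve D '' (s₁ ∩ s₂ : Finset ℝ)) := by
  obtain ⟨R, hR, h1, h2, h3⟩ := h
  refine convexHull_inter_subset_of_polynomial hD (p := (R.map fun r => X - C r).prod)
    ?_ ?_ ?_ ?_
  · rwa [natDegree_multiset_prod_X_sub_C_eq_card]
  · intro t ht ht'
    rw [← sign_eq_one_iff, sign_eval_prod_X_sub_C, h1 t ht ht']
  · intro t ht
    have := h2 t ht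
    rw [← sign_eval_prod_X_sub_C] at this
    exact sign_nonpos_iff.1 this
  · intro t ht ht'
    rw [← sign_eq_zero_iff, sign_eval_prod_X_sub_C, h3 t ht ht']

end rootSign

namespace Hypergraph

/-- A `k`-uniform family of subsets of a finite linear order, any two of which are separated by
few roots, gives a linear embedding along the moment curve, also with isolated vertices added. -/
theorem isLinearEmbedding_of_separatedBy {α β : Type*} [LinearOrder α] [Fintype α] {D k : ℕ}
    (hD : 0 < D) (hk : k ≤ D + 1) (hk0 : 0 < k) {E : Set (Finset α)}
    (hE : ∀ e ∈ E, e.card = k)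
    (hsep : ∀ e₁ ∈ E, ∀ e₂ ∈ E, e₁ ≠ e₂ → SeparatedBy D e₁ e₂ ∨ SeparatedBy D e₂ e₁)
    {H : Hypergraph (α ⊕ β)} (hH : H.edgeSet = (fun e : Finset α => Sum.inl '' (e : Set α)) '' E) :
    ∃ φ : α ⊕ β → (Fin D → ℝ), H.IsLinearEmbedding k D φ := by
  classical
  obtain ⟨f, hf⟩ : ∃ f : α → ℝ, StrictMono f := by
    let g := (Fintype.orderIsoFinOfCardEq α rfl).symm
    exact ⟨fun a => ((g a : ℕ) : ℝ), fun a b hab => Nat.cast_lt.2 (g.strictMono hab)⟩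
  have himg : ∀ e : Finset α, Sum.elim (fun a => momentCurve D (f a)) (fun _ : β => 0) ''
      (Sum.inl '' (e : Set α)) = momentCurve D '' (e.image f : Finset ℝ) := by
    intro e
    rw [Set.image_image, Finset.coe_image, Set.image_image]
    rfl
  -- The added vertices lie in no edge, so their common image 0 is harmless.
  refine ⟨Sum.elim (fun a => momentCurve D (f a)) fun _ => 0, ?_, ?_⟩
  · rw [hH]
    rintro _ ⟨e, he, rfl⟩
    rw [himg, Finset.coe_image, Set.image_image, Set.image_eq_range, direction_affineSpan]
    refine AffineIndependent.finrank_vectorSpan (ι := (e : Set α))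
      (affineIndependent_momentCurve (D := D) (t := fun i : (e : Set α) => f i) ?_ ?_) ?_
    · exact hf.injective.comp Subtype.val_injective
    · simpa [hE e he] using hk
    · simp [hE e he]; omega
  · rw [hH]
    rintro _ ⟨e₁, he₁, rfl⟩ _ ⟨e₂, he₂, rfl⟩
    refine subset_antisymm (Set.subset_inter
      (convexHull_mono (Set.image_mono Set.inter_subset_left))
      (convexHull_mono (Set.image_mono Set.inter_subset_right))) ?_
    dsimp only
    rw [← Set.image_inter Sum.inl_injective, ← Finset.coe_inter, himg, himg, himg,
      Finset.image_inter _ _ hf.injective]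
    by_cases h : e₁ = e₂
    · subst h; simp
    · rcases hsep e₁ he₁ e₂ he₂ h with h | h
      · exact (h.image hf).convexHull_inter_subset hD
      · rw [Set.inter_comm, Finset.inter_comm]
        exact (h.image hf).convexHull_inter_subset hD

end Hypergraph

/-! ### The stacked order of base points and copies -/

/-- The `(k + 2)`-element subsets of `Fin N`. -/
abbrev BlockIndex (N k : ℕ) : Type := {S : Finset (Fin N) // S.card = k + 2}

namespace BlockIndex

variable {N k : ℕ}

theorem nonempty (S : BlockIndex N k) : S.1.Nonempty := by
  rw [← Finset.card_pos, S.2]; omega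

/-- The least element of a block index. -/
def lo (S : BlockIndex N k) : Fin N := S.1.min' S.nonempty

/-- The greatest element of a block index. -/
def hi (S : BlockIndex N k) : Fin N := S.1.max' S.nonempty

theorem lo_mem (S : BlockIndex N k) : S.lo ∈ S.1 := Finset.min'_mem _ _

theorem hi_mem (S : BlockIndex N k) : S.hi ∈ S.1 := Finset.max'_mem _ _

theorem lo_le (S : BlockIndex N k) {i : Fin N} (h : i ∈ S.1) : S.lo ≤ i := Finset.min'_le _ _ h

theorem le_hi (S : BlockIndex N k) {i : Fin N} (h : i ∈ S.1) : i ≤ S.hi := Finset.le_max' _ _ h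

theorem lo_lt_hi (S : BlockIndex N k) : S.lo < S.hi :=
  Finset.min'_lt_max'_of_card _ (by rw [S.2]; omega)

/-- An enumeration of the block indices. -/
noncomputable def code (S : BlockIndex N k) : Fin (Fintype.card (BlockIndex N k)) :=
  Fintype.equivFin _ S

theorem code_injective : Function.Injective (code : BlockIndex N k → _) :=
  (Fintype.equivFin _).injective

end BlockIndex

/-- The linear order in which the base point `i : Fin N` is followed by copies of `α`, one for
each block index with greatest element `i`, in the order of the least elements of these. (The
order also has points which belong to no block index.) -/
abbrev StackedOrder (N k : ℕ) (α : Type) : Type :=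
  Fin N ×ₗ WithBot (Fin N ×ₗ (Fin (Fintype.card (BlockIndex N k)) ×ₗ α))

namespace StackedOrder

theorem card_eq (N k : ℕ) (α : Type) [Fintype α] :
    Fintype.card (StackedOrder N k α) =
      N * (N * (N.choose (k + 2) * Fintype.card α) + 1) := by
  have h : Fintype.card (BlockIndex N k) = N.choose (k + 2) := by
    simp [BlockIndex]
  change Fintype.card (Fin N × Option (Fin N × (Fin _ × α))) = _
  simp only [Fintype.card_prod, Fintype.card_option, Fintype.card_fin, h]

variable {N k : ℕ} {α : Type}

/-- The base point `i`. -/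
def base (i : Fin N) : StackedOrder N k α := toLex (i, ⊥)

/-- The point `v` of the copy of `α` belonging to `S`. -/
noncomputable def block (S : BlockIndex N k) (v : α) : StackedOrder N k α :=
  toLex (S.hi, ((toLex (S.lo, toLex (S.code, v)) : Fin N ×ₗ _) : WithBot _))

variable [LinearOrder α] {i j : Fin N} {S S' : BlockIndex N k} {v w : α}

theorem base_lt_base : (base i : StackedOrder N k α) < base j ↔ i < j := by
  simp [base, Prod.Lex.toLex_lt_toLex]

theorem base_injective : Function.Injective (base : Fin N → StackedOrder N k α) :=
  StrictMono.injective fun _ _ h => base_lt_base.2 h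

theorem base_lt_block : base i < block S v ↔ i ≤ S.hi := by
  simp [base, block, Prod.Lex.toLex_lt_toLex, le_iff_lt_or_eq]

theorem block_lt_base : block S v < base i ↔ S.hi < i := by
  simp [base, block, Prod.Lex.toLex_lt_toLex]

theorem block_lt_block : block S v < block S' w ↔ S.hi < S'.hi ∨ S.hi = S'.hi ∧
    (S.lo < S'.lo ∨ S.lo = S'.lo ∧ (S.code < S'.code ∨ S.code = S'.code ∧ v < w)) := by
  simp [block, Prod.Lex.toLex_lt_toLex]

theorem block_strictMono (S : BlockIndex N k) :
    StrictMono (block S : α → StackedOrder N k α) := fun v w h => by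
  simp [block_lt_block, h]

theorem base_ne_block : base i ≠ block S v := by
  intro h
  have h1 := (base_lt_block (i := i) (S := S) (v := v)).not.1 h.not_lt
  have h2 := (block_lt_base (i := i) (S := S) (v := v)).not.1 h.not_gt
  exact h1 (not_lt.1 h2)

/-- The point of a copy is the last lexicographic key, so distinct copies occupy disjoint intervals.
-/
theorem blocks_separated (h : S ≠ S') :
    (∀ v w : α, block S v < block S' w) ∨ ∀ v w : α, block S' w < block S v := by
  have hc : S.code ≠ S'.code := fun hc => h (BlockIndex.code_injective hc)
  simp only [block_lt_block]
  rcases lt_trichotomy S.hi S'.hi with h1 | h1 | h1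
  · exact Or.inl fun _ _ => Or.inl h1
  · rcases lt_trichotomy S.lo S'.lo with h2 | h2 | h2
    · exact Or.inl fun _ _ => Or.inr ⟨h1, Or.inl h2⟩
    · rcases lt_or_gt_of_ne hc with h3 | h3
      · exact Or.inl fun _ _ => Or.inr ⟨h1, Or.inr ⟨h2, Or.inl h3⟩⟩
      · exact Or.inr fun _ _ => Or.inr ⟨h1.symm, Or.inr ⟨h2.symm, Or.inl h3⟩⟩
    · exact Or.inr fun _ _ => Or.inr ⟨h1.symm, Or.inl h2⟩
  · exact Or.inr fun _ _ => Or.inl h1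

/-- The edge consisting of the base points in `S` and of a point of the copy belonging to `S`. -/
noncomputable def cone (S : BlockIndex N k) (v : α) : Finset (StackedOrder N k α) :=
  insert (block S v) (S.1.image base)

theorem card_cone (S : BlockIndex N k) (v : α) : (cone S v).card = k + 3 := by
  rw [cone, Finset.card_insert_of_notMem, Finset.card_image_of_injective _ base_injective, S.2]
  simp [base_ne_block]

end StackedOrder

/-! ### Separating the edges of the stacked family -/

/-- A set is separated from any set that avoids its order hull. -/
theorem separatedBy_of_interval {α : Type*} [LinearOrder α] {D : ℕ} (hD : 2 ≤ D)
    {e T : Finset α} (hT : T.Nonempty)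
    (h : ∀ x ∈ e, (∀ t ∈ T, x < t) ∨ ∀ t ∈ T, t < x) : SeparatedBy D e T := by
  have hmin := T.min'_mem hT
  have hmax := T.max'_mem hT
  refine ⟨{T.min' hT, T.max' hT}, by simpa using hD, ?_, ?_, ?_⟩
  · intro x hx _
    rcases h x hx with h | h
    · simp [rootSign, ordSign_of_lt (h _ hmin), ordSign_of_lt (h _ hmax)]
    · simp [rootSign, ordSign_of_gt (h _ hmin), ordSign_of_gt (h _ hmax)]
  · intro t ht
    simp only [rootSign, Multiset.insert_eq_cons, Multiset.map_cons, Multiset.map_singleton,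
      Multiset.prod_cons, Multiset.prod_singleton]
    rcases (T.min'_le t ht).eq_or_lt with h1 | h1
    · simp [h1]
    · rcases (T.le_max' t ht).eq_or_lt with h2 | h2
      · simp [← h2]
      · rw [ordSign_of_gt h1, ordSign_of_lt h2]; decide
  · intro x hx hxT
    rcases h x hx with h | h <;> exact absurd (h x hxT) (lt_irrefl x)

namespace StackedOrder

variable {N k : ℕ} {α : Type} [LinearOrder α] {S S' : BlockIndex N k} {v w : α}

theorem separatedBy_block_block {T T' : Finset α} (h : S ≠ S') (hT : T.Nonempty) :
    SeparatedBy (2 * k + 3) (T'.image (block S')) (T.image (block S)) := by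
  refine separatedBy_of_interval (by omega) (hT.image _) ?_
  simp only [Finset.forall_mem_image]
  intro x _
  exact (blocks_separated h.symm).imp (fun h t _ => h x t) fun h t _ => h x t

theorem separatedBy_cone_block_of_ne {T : Finset α} (h : S ≠ S') (hT : T.Nonempty) :
    SeparatedBy (2 * k + 3) (cone S' v) (T.image (block S)) := by
  refine separatedBy_of_interval (by omega) (hT.image _) ?_
  simp only [cone, Finset.forall_mem_image, Finset.forall_mem_insert]
  refine ⟨(blocks_separated h.symm).imp (fun h t _ => h v t) fun h t _ => h v t, fun i _ => ?_⟩
  simp only [base_lt_block, block_lt_base]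
  exact (le_or_gt i S.hi).imp (fun h _ _ => h) fun h _ _ => h

/-- A simple root at the greatest base point of `S` changes sign between the base points of `S` and
its copy; a double root at the apex makes the polynomial vanish there without a further sign change.
-/
theorem separatedBy_block_cone (T : Finset α) (S : BlockIndex N k) (v : α) :
    SeparatedBy (2 * k + 3) (T.image (block S)) (cone S v) := by
  refine ⟨{base S.hi, block S v, block S v}, by simp, ?_, ?_, ?_⟩ <;>
    simp only [rootSign, Multiset.insert_eq_cons, Multiset.map_cons, Multiset.map_singleton,
      Multiset.prod_cons, Multiset.prod_singleton]
  · simp only [Finset.forall_mem_image]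
    intro t _ ht
    rw [ordSign_of_gt (base_lt_block.2 le_rfl), one_mul]
    have hne : ordSign (block S t) (block S v) ≠ 0 := by
      rw [Ne, ordSign_eq_zero_iff]
      exact fun h => ht (h ▸ Finset.mem_insert_self _ _)
    revert hne
    generalize ordSign (block S t) (block S v) = s
    revert s
    decide
  · simp only [cone, Finset.forall_mem_image, Finset.forall_mem_insert]
    refine ⟨by simp, fun i hi => ?_⟩
    rcases (S.le_hi hi).eq_or_lt with h | h
    · simp [h]
    · rw [ordSign_of_lt (base_lt_base.2 h), ordSign_of_lt (base_lt_block.2 h.le)]; decide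
  · simp only [Finset.forall_mem_image]
    intro t _ ht
    rcases Finset.mem_insert.1 ht with h | h
    · simp [h]
    · obtain ⟨i, -, h⟩ := Finset.mem_image.1 h
      exact absurd h base_ne_block

/-- Take every vertex of the lower cone as a root: simple at its least and greatest base points and
at its apex, double at the `k` middle ones, in total `2 * k + 3`. Negative values occur only before
the least base point or between the greatest one and the apex, and the order keeps the other cone
out of both regions. -/
theorem separatedBy_cone_cone (h : S'.lo < S.lo ∨ S'.lo = S.lo ∧
    (S'.code < S.code ∨ S'.code = S.code ∧ w < v)) :
    SeparatedBy (2 * k + 3) (cone S v) (cone S' w) := by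
  let Q : Multiset (StackedOrder N k α) := ((S'.1.erase S'.lo).erase S'.hi).val.map base
  let R := base S'.lo ::ₘ base S'.hi ::ₘ block S' w ::ₘ (Q + Q)
  have hQ : Q.card = k := by
    rw [Multiset.card_map, Finset.card_val, Finset.card_erase_of_mem, Finset.card_erase_of_mem,
      S'.2]
    · omega
    · exact S'.lo_mem
    · exact Finset.mem_erase.2 ⟨S'.lo_lt_hi.ne', S'.hi_mem⟩
  have hRmem : ∀ t, t ∈ R ↔ t ∈ cone S' w := by
    intro t
    have : t ∈ Q ↔ ∃ i, (i ≠ S'.hi ∧ i ≠ S'.lo ∧ i ∈ S'.1) ∧ base i = t := by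
      simp only [Q, Multiset.mem_map, Finset.mem_val, Finset.mem_erase]
    simp only [R, Multiset.mem_cons, Multiset.mem_add, or_self, this, cone, Finset.mem_insert,
      Finset.mem_image]
    constructor
    · rintro (rfl | rfl | h | ⟨i, ⟨-, -, hi⟩, rfl⟩)
      · exact Or.inr ⟨_, S'.lo_mem, rfl⟩
      · exact Or.inr ⟨_, S'.hi_mem, rfl⟩
      · exact Or.inl h
      · exact Or.inr ⟨i, hi, rfl⟩
    · rintro (h | ⟨i, hi, rfl⟩)
      · exact Or.inr (Or.inr (Or.inl h))
      · by_cases h1 : i = S'.lo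
        · exact Or.inl (by rw [h1])
        · by_cases h2 : i = S'.hi
          · exact Or.inr (Or.inl (by rw [h2]))
          · exact Or.inr (Or.inr (Or.inr ⟨i, ⟨h2, h1, hi⟩, rfl⟩))
  have hzero : ∀ t ∈ cone S' w, rootSign R t = 0 := fun t ht =>
    rootSign_eq_zero_iff.2 ((hRmem t).2 ht)
  refine ⟨R, by simp [R, hQ]; omega, ?_, fun t ht => (hzero t ht).le, fun t _ ht => hzero t ht⟩
  intro t ht htn
  have htR : t ∉ R := (hRmem t).not.2 htn
  have hlo : S'.lo ≤ S.lo := by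
    rcases h with h | h
    exacts [h.le, h.1.le]
  have hbase : base S'.lo ≤ t := by
    rcases Finset.mem_insert.1 ht with rfl | ht
    · exact (base_lt_block.2 (hlo.trans S.lo_lt_hi.le)).le
    · obtain ⟨i, hi, rfl⟩ := Finset.mem_image.1 ht
      exact not_lt.1 fun h' => (base_lt_base.1 h').not_ge (hlo.trans (S.lo_le hi))
  -- Between `base S'.hi` and its apex lie only copies attached at `S'.hi` with smaller keys; `h`
  -- says the apex of `S` has a larger key.
  have hout : t < base S'.hi ∨ block S' w < t := by
    rcases Finset.mem_insert.1 ht with rfl | ht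
    · rw [block_lt_base, block_lt_block]
      rcases lt_trichotomy S.hi S'.hi with h1 | h1 | h1
      · exact Or.inl h1
      · exact Or.inr (Or.inr ⟨h1.symm, h⟩)
      · exact Or.inr (Or.inl h1)
    · obtain ⟨i, hi, rfl⟩ := Finset.mem_image.1 ht
      rw [base_lt_base, block_lt_base]
      refine lt_or_gt_of_ne ?_
      rintro rfl
      exact htR (by simp [R])
  have hhi : (base S'.hi : StackedOrder N k α) < block S' w := base_lt_block.2 le_rfl
  simp only [R, rootSign_cons, rootSign_add]
  have hQt : rootSign Q t * rootSign Q t = 1 := by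
    have hne : rootSign Q t ≠ 0 := by
      rw [Ne, rootSign_eq_zero_iff]
      exact fun hm => htR (by simp [R, hm])
    revert hne
    generalize rootSign Q t = s
    revert s
    decide
  rw [hQt, mul_one, ordSign_of_gt (lt_of_le_of_ne hbase fun h' => htR (by simp [R, h'])), one_mul]
  rcases hout with h' | h'
  · rw [ordSign_of_lt h', ordSign_of_lt (h'.trans hhi)]; decide
  · rw [ordSign_of_gt h', ordSign_of_gt (hhi.trans h')]; decide

theorem separatedBy_cone_cone_or (h : cone S v ≠ cone S' w) :
    SeparatedBy (2 * k + 3) (cone S v) (cone S' w) ∨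
      SeparatedBy (2 * k + 3) (cone S' w) (cone S v) := by
  rcases lt_trichotomy S.lo S'.lo with h1 | h1 | h1
  · exact Or.inr (separatedBy_cone_cone (Or.inl h1))
  · rcases lt_trichotomy S.code S'.code with h2 | h2 | h2
    · exact Or.inr (separatedBy_cone_cone (Or.inr ⟨h1, Or.inl h2⟩))
    · rcases lt_trichotomy v w with h3 | h3 | h3
      · exact Or.inr (separatedBy_cone_cone (Or.inr ⟨h1, Or.inr ⟨h2, h3⟩⟩))
      · exact absurd (by rw [BlockIndex.code_injective h2, h3]) h
      · exact Or.inl (separatedBy_cone_cone (Or.inr ⟨h1.symm, Or.inr ⟨h2.symm, h3⟩⟩))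
    · exact Or.inl (separatedBy_cone_cone (Or.inr ⟨h1.symm, Or.inl h2⟩))
  · exact Or.inl (separatedBy_cone_cone (Or.inl h1))

end StackedOrder

/-! ### The inductive construction and its size -/

/-- A `(k + 3)`-uniform family whose members are pairwise separated by at most `2 k + 3` roots, and
which has no weak coloring with `c` colors. -/
structure IsUncolorableFamily {α : Type} [LinearOrder α] (k c : ℕ) (E : Set (Finset α)) : Prop where
  card_eq : ∀ e ∈ E, e.card = k + 3
  separated : ∀ e₁ ∈ E, ∀ e₂ ∈ E, e₁ ≠ e₂ →
    SeparatedBy (2 * k + 3) e₁ e₂ ∨ SeparatedBy (2 * k + 3) e₂ e₁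
  exists_mono : ∀ κ : α → Fin c, ∃ e ∈ E, ∃ a, ∀ x ∈ e, κ x = a

open StackedOrder in
/-- The edges of the copies of a family, together with all cones. -/
def stackedFamily {α : Type} [LinearOrder α] (N k : ℕ) (E : Set (Finset α)) :
    Set (Finset (StackedOrder N k α)) :=
  {e | (∃ S : BlockIndex N k, ∃ T ∈ E, e = T.image (block S)) ∨
    ∃ (S : BlockIndex N k) (v : α), e = cone S v}

open StackedOrder in
theorem IsUncolorableFamily.stacked {α : Type} [LinearOrder α] {k c : ℕ} {E : Set (Finset α)}
    (hE : IsUncolorableFamily k c E) {N : ℕ} (hN : (c + 1) * (k + 1) < N) :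
    IsUncolorableFamily k (c + 1) (stackedFamily N k E) where
  card_eq := by
    rintro e (⟨S, T, hT, rfl⟩ | ⟨S, v, rfl⟩)
    · rw [Finset.card_image_of_injective _ (block_strictMono S).injective, hE.card_eq T hT]
    · exact card_cone S v
  separated := by
    have hne : ∀ T ∈ E, T.Nonempty := fun T hT => by
      rw [← Finset.card_pos, hE.card_eq T hT]; omega
    have hbc : ∀ (S S' : BlockIndex N k) (T : Finset α) (v : α), T ∈ E →
        SeparatedBy (2 * k + 3) (T.image (block S)) (cone S' v) ∨
          SeparatedBy (2 * k + 3) (cone S' v) (T.image (block S)) := by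
      intro S S' T v hT
      by_cases h : S = S'
      · subst h
        exact Or.inl (separatedBy_block_cone T S v)
      · exact Or.inr (separatedBy_cone_block_of_ne h (hne T hT))
    rintro _ (⟨S, T, hT, rfl⟩ | ⟨S, v, rfl⟩) _ (⟨S', T', hT', rfl⟩ | ⟨S', v', rfl⟩) h
    · by_cases hS : S = S'
      · subst hS
        exact (hE.separated T hT T' hT' fun h' => h (by rw [h'])).imp
          (fun h => h.image (block_strictMono S)) fun h => h.image (block_strictMono S)
      · exact Or.inr (separatedBy_block_block hS (hne T hT))
    · exact hbc S S' T v' hT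
    · exact (hbc S' S T' v hT').symm
    · exact separatedBy_cone_cone_or h
  exists_mono := by
    intro κ
    obtain ⟨a, ha⟩ := Fintype.exists_lt_card_fiber_of_mul_lt_card
      (fun i : Fin N => κ (base i)) (n := k + 1) (by simpa using hN)
    obtain ⟨S, hS, hcard⟩ := Finset.exists_subset_card_eq (Nat.succ_le_of_lt ha)
    let I : BlockIndex N k := ⟨S, hcard⟩
    by_cases hv : ∃ v, κ (block I v) = a
    · obtain ⟨v, hv⟩ := hv
      refine ⟨cone I v, Or.inr ⟨I, v, rfl⟩, a, ?_⟩
      simp only [cone, Finset.forall_mem_insert, Finset.forall_mem_image]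
      exact ⟨hv, fun i hi => (Finset.mem_filter.1 (hS hi)).2⟩
    · push Not at hv
      -- The copy avoids the color `a`; deleting it from `Fin (c + 1)` leaves a coloring by `Fin c`.
      choose κ' hκ' using fun v => Fin.exists_succAbove_eq (hv v)
      obtain ⟨e, he, b, hb⟩ := hE.exists_mono κ'
      refine ⟨e.image (block I), Or.inl ⟨I, e, he, rfl⟩, a.succAbove b, ?_⟩
      simp only [Finset.forall_mem_image]
      exact fun x hx => by rw [← hκ', hb x hx]

/-- There are uncolorable families of size `c ^ O(c)`. -/
theorem exists_isUncolorableFamily (k c : ℕ) :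
    ∃ (α : Type) (_ : LinearOrder α) (_ : Fintype α) (E : Set (Finset α)),
      IsUncolorableFamily k c E ∧ 0 < Fintype.card α ∧
        Fintype.card α ≤ ((k + 2) * (c + 1)) ^ ((k + 5) * c) := by
  induction c with
  | zero =>
    exact ⟨Fin 1, inferInstance, inferInstance, ∅,
      ⟨by simp, by simp, fun κ => (κ 0).elim0⟩, by simp, by simp⟩
  | succ c ih =>
    obtain ⟨α, _, _, E, hE, hpos, hcard⟩ := ih
    let N := (c + 1) * (k + 1) + 1
    refine ⟨StackedOrder N k α, inferInstance, inferInstance, stackedFamily N k E,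
      hE.stacked (Nat.lt_succ_self _), ?_, ?_⟩
    · rw [StackedOrder.card_eq]; positivity
    · rw [StackedOrder.card_eq]
      have hB : N ≤ (k + 2) * (c + 1 + 1) := by simp only [N]; nlinarith
      have hB' : (k + 2) * (c + 1) ≤ (k + 2) * (c + 1 + 1) := by gcongr; omega
      have hB2 : 2 ≤ (k + 2) * (c + 1 + 1) := by nlinarith
      generalize (k + 2) * (c + 1 + 1) = B at hB hB' hB2 ⊢
      have h1 : N.choose (k + 2) ≤ B ^ (k + 2) :=
        (Nat.choose_le_pow _ _).trans (Nat.pow_le_pow_left hB _)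
      have h2 : Fintype.card α ≤ B ^ ((k + 5) * c) := hcard.trans (Nat.pow_le_pow_left hB' _)
      -- One step costs `k + 5` factors of `B`: two for `N`, `k + 2` for the binomial, and one for
      -- the 2 that absorbs the `+ 1`.
      calc N * (N * (N.choose (k + 2) * Fintype.card α) + 1)
          ≤ B * (B * (B ^ (k + 2) * B ^ ((k + 5) * c)) +
              B * (B ^ (k + 2) * B ^ ((k + 5) * c))) := by
            gcongr
            exact Nat.one_le_iff_ne_zero.2 (by positivity)
        _ = 2 * B ^ (k + 4 + (k + 5) * c) := by ring
        _ ≤ B * B ^ (k + 4 + (k + 5) * c) := by gcongr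
        _ = B ^ ((k + 5) * (c + 1)) := by ring

/-! ### From families to the asymptotic bound -/

namespace Hypergraph

theorem lt_maxWeakChromaticNumber {α : Type} [LinearOrder α] [Fintype α] {k c n : ℕ}
    {E : Set (Finset α)} (hE : IsUncolorableFamily k c E) (hn : Fintype.card α ≤ n) :
    c < maxWeakChromaticNumber (2 * k + 3) (k + 3) n := by
  -- Isolated vertices pad the vertex set to exactly `n`.
  let H : Hypergraph (α ⊕ Fin (n - Fintype.card α)) :=
    { vertexSet := Set.univ
      edgeSet := (fun e : Finset α => Sum.inl '' (e : Set α)) '' E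
      subset_vertexSet_of_mem_edgeSet' := fun _ _ => Set.subset_univ _ }
  have hunif : H.IsFiniteUniform (k + 3) := by
    refine ⟨Set.toFinite _, ?_⟩
    rintro _ ⟨e, he, rfl⟩
    rw [Set.ncard_image_of_injective _ Sum.inl_injective, Set.ncard_coe_finset, hE.card_eq e he]
  have hmem : H.weakChromaticNumber ∈ weakChromaticNumbers (2 * k + 3) (k + 3) n := by
    refine ⟨_, H, ⟨hunif, ?_⟩, ?_, rfl⟩
    · exact isLinearEmbedding_of_separatedBy (by omega) (by omega) (by omega) hE.card_eq
        hE.separated rfl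
    · change (Set.univ : Set (α ⊕ Fin (n - Fintype.card α))).ncard = n
      rw [Set.ncard_univ, Nat.card_eq_fintype_card]
      simp
      omega
  refine lt_of_lt_of_le ?_ ((isGreatest_maxWeakChromaticNumber (by omega)).2 hmem)
  have hne : {c : ℕ | ∃ κ, H.IsWeakColoring c κ}.Nonempty :=
    ⟨_, hunif.exists_isWeakColoring (by omega)⟩
  obtain ⟨κ, hκ, hκE⟩ := Nat.sInf_mem hne
  by_contra hle
  have hle : H.weakChromaticNumber ≤ c := not_lt.1 hle
  have hκ' : ∀ v, 1 ≤ κ v ∧ κ v ≤ c := fun v =>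
    ⟨(hκ v (Set.mem_univ v)).1, (hκ v (Set.mem_univ v)).2.trans hle⟩
  obtain ⟨e, he, a, ha⟩ := hE.exists_mono fun v => ⟨κ (Sum.inl v) - 1, by
    have := hκ' (Sum.inl v); omega⟩
  have h1 := hκE _ ⟨e, he, rfl⟩
  refine h1.not_ge ((Set.ncard_le_one_iff (Set.toFinite _)).2 ?_)
  have hval : ∀ y ∈ κ '' (Sum.inl '' (e : Set α)), y = a + 1 := by
    rintro _ ⟨_, ⟨x, hx, rfl⟩, rfl⟩
    have := congrArg Fin.val (ha x hx)
    have := hκ' (Sum.inl x)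
    simp only at *
    omega
  exact fun _ _ hx hy => (hval _ hx).trans (hval _ hy).symm

theorem lt_maxWeakChromaticNumber_of_pow_le {k c n : ℕ}
    (hn : ((k + 2) * (c + 1)) ^ ((k + 5) * c) ≤ n) :
    c < maxWeakChromaticNumber (2 * k + 3) (k + 3) n := by
  obtain ⟨α, _, _, E, hE, -, hcard⟩ := exists_isUncolorableFamily k c
  exact lt_maxWeakChromaticNumber hE (hcard.trans hn)

end Hypergraph

theorem mainTheorem1 (d : ℕ) (hd : 3 ≤ d) :
    (fun n : ℕ => Real.log (n : ℝ) / Real.log (Real.log (n : ℝ)))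
      =O[Filter.atTop]
    (fun n : ℕ => (Hypergraph.maxWeakChromaticNumber (2 * d - 3) d n : ℝ)) := by
  obtain ⟨k, rfl⟩ := Nat.exists_eq_add_of_le' hd
  rw [show 2 * (k + 3) - 3 = 2 * k + 3 by omega]
  have hlog : Filter.Tendsto (fun n : ℕ => Real.log (n : ℝ)) Filter.atTop Filter.atTop :=
    Real.tendsto_log_atTop.comp tendsto_natCast_atTop_atTop
  have hloglog := Real.tendsto_log_atTop.comp hlog
  refine Asymptotics.IsBigO.of_bound (2 * ((k : ℝ) + 5)) ?_
  filter_upwards [hlog.eventually_ge_atTop 2, hloglog.eventually_ge_atTop 1,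
    hloglog.eventually_ge_atTop (Real.log (k + 2)), Filter.eventually_gt_atTop 0]
    with n hL hLL1 hLLk hn
  simp only [Function.comp_apply] at hLL1 hLLk
  generalize hLdef : Real.log (n : ℝ) = L at hL hLL1 hLLk ⊢
  generalize hMdef : Real.log L = M at hLL1 hLLk ⊢
  have hM0 : 0 < M := by linarith
  -- The logarithm of the size bound is `(k + 5) * c * (log (k + 2) + log (c + 1))`, and both
  -- logarithms are eventually at most `M = log log n`. So `c ≤ q` keeps it below `L = log n`.
  let q : ℝ := L / (2 * ((k : ℝ) + 5) * M)
  have hq0 : 0 ≤ q := by positivity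
  have hq : 2 * ((k : ℝ) + 5) * M * q = L := by
    simp only [q]; field_simp
  let c : ℕ := ⌊q⌋₊
  have hcq : (c : ℝ) ≤ q := Nat.floor_le hq0
  have hqL : q + 1 ≤ L := by
    have h10 : 10 * q ≤ L := by
      rw [← hq]
      have : 10 ≤ 2 * ((k : ℝ) + 5) * M := by nlinarith [(Nat.cast_nonneg k : (0 : ℝ) ≤ k)]
      exact mul_le_mul_of_nonneg_right this hq0
    linarith
  have hpow : ((k + 2) * (c + 1)) ^ ((k + 5) * c) ≤ n := by
    have hpos : (0 : ℝ) < (((k + 2) * (c + 1)) ^ ((k + 5) * c) : ℕ) := by positivity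
    have hn' : (0 : ℝ) < n := by exact_mod_cast hn
    rw [← Nat.cast_le (α := ℝ), ← Real.log_le_log_iff hpos hn', hLdef]
    push_cast
    rw [Real.log_pow, Real.log_mul (by positivity) (by positivity)]
    have hc1 : Real.log ((c : ℝ) + 1) ≤ M := by
      rw [← hMdef]
      exact Real.log_le_log (by positivity) (by linarith)
    push_cast
    calc ((k : ℝ) + 5) * c * (Real.log ((k : ℝ) + 2) + Real.log ((c : ℝ) + 1))
        ≤ ((k : ℝ) + 5) * q * (M + M) := by
          have h1 : 0 ≤ Real.log ((k : ℝ) + 2) :=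
            Real.log_nonneg (by linarith [(Nat.cast_nonneg k : (0 : ℝ) ≤ k)])
          have h2 : 0 ≤ Real.log ((c : ℝ) + 1) :=
            Real.log_nonneg (by linarith [(Nat.cast_nonneg c : (0 : ℝ) ≤ c)])
          gcongr
      _ = L := by rw [← hq]; ring
  have hlt := Hypergraph.lt_maxWeakChromaticNumber_of_pow_le hpow
  -- The strict inequality for `c = ⌊q⌋₊` compensates for rounding down.
  have hqm : q ≤ (Hypergraph.maxWeakChromaticNumber (2 * k + 3) (k + 3) n : ℝ) := by
    refine (Nat.lt_floor_add_one q).le.trans ?_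
    exact_mod_cast hlt
  rw [Real.norm_of_nonneg (by positivity), Real.norm_of_nonneg (Nat.cast_nonneg _)]
  calc L / M = 2 * ((k : ℝ) + 5) * q := by simp only [q]; field_simp
    _ ≤ _ := by gcongr
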